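/- Let $n\ge 3$ and $k\ge 2$. Cut the cube $[0,k]^n$ into $k^n$ unit cubies $\prod_{i=1}^n[a_i,a_i+1]$ with $a_i\in\{0,\dots,k-1\}$. A $t$-dimensional layer consists of all cubies for which $n-t$ of the indices $a_i$ have prescribed values and the other $t\ge 2$ indices are free. A turn of a layer applies to its cubies, together with their faces, a quarter turn about the centre of the cube in the plane of two different free coordinates $i,j$ (it replaces $x_i$ by $k-x_j$ and $x_j$ by $x_i$) and leaves all other cubies in place. A combination is a finite sequence of turns of layers. A cubie is outer if $a_i\in\{0,k-1\}$ for at least one $i$. Two cubies are linked if some combination takes the first to the position of the second; a class is an equivalence class of outer cubies under this relation. If $k$ is odd, the frame is the class consisting of the $2n$ cubies for which exactly one index is $0$ or $k-1$ and all the others are equal to $(k-1)/2$. If a cubie has exactly $m\geq 1$ indices in $\{0,k-1\}$, its orientation faces are its $m$ faces of dimension $n+1-m$ obtained by choosing $m-1$ of these $m$ coordinates and replacing in each of them the segment $[a_i,a_i+1]$ by the end point $0$ or $k$ of $[0,k]$ that it contains. The state of a cubie consists of its position and of the positions of all its orientation faces (of its position only, if the cubie is not outer). Theorem. Let $C$ be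 a class of cubies other than the frame. Then every even permutation $\pi$ of $C$ can be carried out carefully: there is a combination of turns of layers which takes each cubie $c\in C$ to the position of $\pi(c)$ and leaves unchanged the state of every cubie outside $C$. (The orientations of the cubies of $C$ themselves may change.) -/

import Mathlib

/-- A position of a unit cubie in the `n`-dimensional cube with edge length `k`:
`p` stands for the box `∏ i, [p i, p i + 1]` inside `[0, k]^n`. -/
abbrev CubiePos (n k : ℕ) : Type := Fin n → Fin k

/-- The segment `[a, a + 1]` touches an end point of `[0, k]`, i.e. `a = 0` or `a = k - 1`. -/
def IsBoundaryIndex {k : ℕ} (a : Fin k) : Prop := (a : ℕ) = 0 ∨ (a : ℕ) + 1 = k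

instance {k : ℕ} : DecidablePred (IsBoundaryIndex (k := k)) := fun a =>
  inferInstanceAs (Decidable ((a : ℕ) = 0 ∨ (a : ℕ) + 1 = k))

/-- The segment `[a, a + 1]` is the middle segment of `[0, k]`, i.e. `a = (k - 1) / 2` with `k` odd. -/
def IsMiddleIndex {k : ℕ} (a : Fin k) : Prop := 2 * (a : ℕ) + 1 = k

theorem IsBoundaryIndex.rev {k : ℕ} {a : Fin k} (h : IsBoundaryIndex a) :
    IsBoundaryIndex a.rev := by
  unfold IsBoundaryIndex at *
  rw [Fin.val_rev]
  omega

/-- The coordinates along which a cubie touches the boundary of the big cube. -/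
def boundaryCoords {n k : ℕ} (p : CubiePos n k) : Finset (Fin n) :=
  Finset.univ.filter fun i => IsBoundaryIndex (p i)

/-- The quarter turn in the plane of the coordinates `i`, `j` about the centre of the cube
(`x_i ↦ k - x_j`, `x_j ↦ x_i`), on positions of cubies. The segment opposite to `[a, a + 1]`
under `x ↦ k - x` is `[a.rev, a.rev + 1]`. -/
def rotatePos {n k : ℕ} (i j : Fin n) (p : CubiePos n k) : CubiePos n k :=
  fun l => if l = i then (p j).rev else if l = j then p i else p l

/-- A position of an outer face of a cubie: the product over the coordinates in which a coordinate
`i ∈ pinned` contributes the end point (`0` or `k`) of `[0, k]` that `[cubie i, cubie i + 1]`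
contains, and every other coordinate contributes the segment `[cubie i, cubie i + 1]`.
Its dimension is `n - pinned.card`. -/
@[ext]
structure FacePos (n k : ℕ) where
  cubie : CubiePos n k
  pinned : Finset (Fin n)
  pinned_boundary : ∀ i ∈ pinned, IsBoundaryIndex (cubie i)

/-- The same quarter turn on positions of faces. -/
def rotateFace {n k : ℕ} (i j : Fin n) (f : FacePos n k) : FacePos n k where
  cubie := rotatePos i j f.cubie
  pinned := f.pinned.map (Equiv.swap i j).toEmbedding
  pinned_boundary := by
    intro l hl
    obtain ⟨a, ha, rfl⟩ := Finset.mem_map.1 hl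
    have hb := f.pinned_boundary a ha
    by_cases hi : a = i
    · subst hi
      by_cases hj : j = a
      · subst hj
        simpa [rotatePos] using hb.rev
      · simpa [rotatePos, hj] using hb
    · by_cases hj : a = j
      · subst hj
        simpa [rotatePos] using hb.rev
      · simpa [rotatePos, Equiv.swap_apply_of_ne_of_ne hi hj, hi, hj] using hb

/-- A layer of dimension `free.card`: all cubies whose coordinates outside `free` have prescribed
values. (The values of `value` on `free` play no role.) -/
structure Layer (n k : ℕ) where
  free : Finset (Fin n)
  value : Fin n → Fin k

/-- The cubie at position `p` belongs to the layer. -/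
def Layer.Contains {n k : ℕ} (L : Layer n k) (p : CubiePos n k) : Prop :=
  ∀ l, l ∉ L.free → p l = L.value l

instance {n k : ℕ} (L : Layer n k) : DecidablePred L.Contains := fun p =>
  inferInstanceAs (Decidable (∀ l, l ∉ L.free → p l = L.value l))

/-- A turn of a layer: a quarter turn in the plane of two different free coordinates of the layer.
(Exchanging `i` and `j` gives the inverse turn.) -/
structure LayerTurn (n k : ℕ) where
  layer : Layer n k
  i : Fin n
  j : Fin n
  i_mem : i ∈ layer.free
  j_mem : j ∈ layer.free
  i_ne_j : i ≠ j

/-- Where a turn takes the cubie which stands at position `p`. -/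
def LayerTurn.movePos {n k : ℕ} (t : LayerTurn n k) (p : CubiePos n k) : CubiePos n k :=
  if t.layer.Contains p then rotatePos t.i t.j p else p

/-- Where a turn takes the face which stands at position `f`: it moves with its cubie. -/
def LayerTurn.moveFace {n k : ℕ} (t : LayerTurn n k) (f : FacePos n k) : FacePos n k :=
  if t.layer.Contains f.cubie then rotateFace t.i t.j f else f

/-- A combination of turns; the head of the list is carried out first. -/
abbrev Combination (n k : ℕ) : Type := List (LayerTurn n k)

/-- Where a combination takes the cubie which stands at position `p`. -/
def Combination.movePos {n k : ℕ} (w : Combination n k) (p : CubiePos n k) : CubiePos n k :=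
  w.foldl (fun q t => t.movePos q) p

/-- Where a combination takes the face which stands at position `f`. -/
def Combination.moveFace {n k : ℕ} (w : Combination n k) (f : FacePos n k) : FacePos n k :=
  w.foldl (fun g t => t.moveFace g) f

/-- Two cubies are linked if some combination takes the first to the position of the second. -/
def Linked {n k : ℕ} (p q : CubiePos n k) : Prop :=
  ∃ w : Combination n k, w.movePos p = q

/-- An outer cubie: it touches the boundary of the big cube. -/
def IsOuter {n k : ℕ} (p : CubiePos n k) : Prop := (boundaryCoords p).Nonempty

/-- A class of cubies: an equivalence class of outer cubies under being linked. -/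
def IsCubieClass {n k : ℕ} (C : Finset (CubiePos n k)) : Prop :=
  ∃ p : CubiePos n k, IsOuter p ∧ ∀ q, q ∈ C ↔ Linked p q

/-- A frame position: the centre of a facet of the big cube (`k` odd), i.e. one coordinate is a
boundary one and all the others are middle ones. -/
def IsFramePos {n k : ℕ} (p : CubiePos n k) : Prop :=
  ∃ i, IsBoundaryIndex (p i) ∧ ∀ l, l ≠ i → IsMiddleIndex (p l)

/-- The frame: the class of all frame positions. -/
def IsFrame {n k : ℕ} (C : Finset (CubiePos n k)) : Prop := ∀ p, p ∈ C ↔ IsFramePos p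

/-- `f` is an orientation face of its cubie: if the cubie has `m` boundary coordinates, then
`f` has dimension `n + 1 - m`, i.e. exactly `m - 1` of these coordinates are pinned.
(A cubie with `m = 0` has no orientation faces.) -/
def FacePos.IsOrientation {n k : ℕ} (f : FacePos n k) : Prop :=
  f.pinned.card + 1 = (boundaryCoords f.cubie).card

/-- A combination preserves the state of the cubie at `p`: it keeps the position of the cubie and
the position of each of its orientation faces. -/
def Combination.PreservesState {n k : ℕ} (w : Combination n k) (p : CubiePos n k) : Prop :=
  w.movePos p = p ∧ ∀ f : FacePos n k, f.cubie = p → f.IsOrientation → w.moveFace f = f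

/-- The combination carefully realises the permutation `π` of the set of cubies `C`: each cubie of
`C` goes to the position prescribed by `π`, and the states of all cubies outside `C` are kept. -/
def Combination.CarefullyRealises {n k : ℕ} (w : Combination n k) {C : Finset (CubiePos n k)}
    (π : Equiv.Perm C) : Prop :=
  (∀ p : C, w.movePos p.1 = (π p).1) ∧ ∀ p, p ∉ C → w.PreservesState p

open Equiv MulAction
open scoped commutatorElement

/-! If two permutations `σ`, `τ` move only one common point `p`, their commutator is a three-cycle
on `p`, `σ p`, `τ p`. Here `σ` is a quarter turn of a two-dimensional layer through `p` in the plane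
`i`, `j`. For `τ`, another two-dimensional turn `U` carries `p` off that layer, the parallel layer
through `U p` is turned, and `U` is undone (`planeTurn_disjoint_conj`). A suitable `U` needs a third
coordinate; `exists_third_coordinate` supplies it for every outer cubie that is not in a frame
position. The two motions also have no common moved face outside `p`. A class is closed under all
motions, so the commutator fixes every face outside `C`: the three-cycle is careful. To follow both
actions at once, `turnGroup` consists of pairs of permutations, one of positions and one of faces.
On a single cubie every turn acts like a quarter turn of a two-dimensional layer, so these
three-cycles connect `C`. A group with connecting three-cycles is primitive, and by Jordan's theorem
it contains the alternating group. -/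

/-! ### Permutation groups generated by three-cycles -/

/-- A subgroup whose three-cycles `a ↦ b ↦ c ↦ a` connect all points contains the alternating
group. -/
theorem alternatingGroup_le_of_connected_threeCycles {α : Type*} [Fintype α] [DecidableEq α]
    [Nontrivial α] (N : Subgroup (Perm α)) (r : α → α → Prop)
    (hr : ∀ a b, r a b → ∃ c, a ≠ b ∧ a ≠ c ∧ b ≠ c ∧ swap a b * swap b c ∈ N)
    (hconn : ∀ a b, Relation.ReflTransGen r a b) : alternatingGroup α ≤ N := by
  have htrans : IsPretransitive N α := by
    refine ⟨fun a b => ?_⟩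
    induction hconn a b with
    | refl => exact ⟨1, one_smul _ _⟩
    | @tail b d _ hbd ih =>
      obtain ⟨g, hg⟩ := ih
      obtain ⟨c, hbd', hbc, hdc, hmem⟩ := hr b d hbd
      refine ⟨⟨_, hmem⟩ * g, ?_⟩
      rw [mul_smul, hg]
      change (swap b d * swap d c) b = d
      simp [swap_apply_of_ne_of_ne hbd' hbc]
  have hprim : IsPreprimitive N α := by
    refine { toIsPretransitive := htrans, isTrivialBlock_of_isBlock := ?_ }
    intro B hB
    by_contra hnt
    rw [IsTrivialBlock, not_or] at hnt
    obtain ⟨hsub, huniv⟩ := hnt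
    rw [Set.not_subsingleton_iff] at hsub
    obtain ⟨y, hy⟩ := (Set.ne_univ_iff_exists_notMem B).1 huniv
    obtain ⟨x, hx⟩ := hsub.nonempty
    -- By connectedness some edge leaves the block. Its three-cycle `s` moves `B`, since `s • a =
    -- b`, so `s • B` would have to be disjoint from `B`. A second point `d` of `B` contradicts
    -- this: either `s` fixes `d`, or `d = c` and `s • d = a`.
    obtain ⟨a, b, hab, ha, hb⟩ : ∃ a b, r a b ∧ a ∈ B ∧ b ∉ B := by
      by_contra! hcl
      have : ∀ z, Relation.ReflTransGen r x z → z ∈ B := by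
        intro z hz
        induction hz with
        | refl => exact hx
        | tail _ h ih => exact hcl _ _ h ih
      exact hy (this y (hconn x y))
    obtain ⟨c, hab', hac, hbc, hmem⟩ := hr a b hab
    let s : N := ⟨_, hmem⟩
    have hsa : s • a = b := by
      change (swap a b * swap b c) a = b
      simp [swap_apply_of_ne_of_ne hab' hac]
    have hsc : s • c = a := by
      change (swap a b * swap b c) c = a
      simp
    have key : ∀ d ∈ B, s • d ∉ B := by
      intro d hd hsd
      have h := (isBlock_iff_smul_eq_of_mem.1 hB) hd hsd
      exact hb (by rw [← h, ← hsa]; exact Set.smul_mem_smul_set ha)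
    obtain ⟨d, hd, hda⟩ := hsub.exists_ne a
    by_cases hdc : d = c
    · subst hdc
      exact key d hd (hsc ▸ ha)
    · have hdb : d ≠ b := fun h => hb (h ▸ hd)
      apply key d hd
      have : s • d = d := by
        change (swap a b * swap b c) d = d
        simp [swap_apply_of_ne_of_ne hdb hdc, swap_apply_of_ne_of_ne hda hdb]
      rwa [this]
  obtain ⟨a, b, hab⟩ : ∃ a b, r a b := by
    obtain ⟨x, y, hxy⟩ := exists_pair_ne α
    rcases Relation.ReflTransGen.cases_head (hconn x y) with h | ⟨z, h, _⟩
    · exact absurd h hxy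
    · exact ⟨x, z, h⟩
  obtain ⟨c, hab', hac, hbc, hmem⟩ := hr a b hab
  refine Perm.alternatingGroup_le_of_isPreprimitive_of_isThreeCycle_mem hprim ?_ hmem
  rw [swap_comm a b]
  exact Perm.isThreeCycle_swap_mul_swap_same hab'.symm hbc hac

theorem Perm.apply_inv_self' {S : Type*} (σ : Perm S) (x : S) : σ (σ⁻¹ x) = x :=
  σ.apply_symm_apply x

theorem Perm.inv_apply_self' {S : Type*} (σ : Perm S) (x : S) : σ⁻¹ (σ x) = x :=
  σ.symm_apply_apply x

/-- The commutator of two permutations fixes `x` if none of `x`, `σ⁻¹ x`, `τ⁻¹ x` is moved by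
both of them. -/
theorem commutator_apply_eq_self {S : Type*} (σ τ : Perm S) (x : S)
    (h : σ x = x ∨ τ x = x) (hσ : σ (σ⁻¹ x) = σ⁻¹ x ∨ τ (σ⁻¹ x) = σ⁻¹ x)
    (hτ : σ (τ⁻¹ x) = τ⁻¹ x ∨ τ (τ⁻¹ x) = τ⁻¹ x) : ⁅σ, τ⁆ x = x := by
  simp only [commutatorElement_def, Perm.mul_apply, Perm.apply_inv_self'] at *
  rcases hτ with hτ | hτ
  · rw [Perm.inv_eq_iff_eq.2 hτ.symm, Perm.apply_inv_self']
    rcases h with h | h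
    · exact h
    · have h' : τ⁻¹ x = x := Perm.inv_eq_iff_eq.2 h.symm
      rwa [h'] at hτ
  · rw [← hτ]
    rcases hσ with hσ | hσ
    · rw [← hσ, ← Perm.inv_eq_iff_eq.1 hτ.symm, ← Perm.inv_eq_iff_eq.1 hσ.symm]
    · rw [hσ, Perm.apply_inv_self']

/-- If `p` is the only point moved both by `σ` and by `τ`, then their commutator is the three-cycle
`p ↦ σ p ↦ τ p ↦ p`. -/
theorem commutator_eq_threeCycle {S : Type*} [DecidableEq S] (σ τ : Perm S) (p : S)
    (hσ : σ p ≠ p) (hτ : τ p ≠ p) (h : ∀ x, x ≠ p → σ x = x ∨ τ x = x) :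
    σ p ≠ τ p ∧ ⁅σ, τ⁆ = swap p (σ p) * swap (σ p) (τ p) := by
  -- As `p` is the only common moved point, the images and preimages of `p` under one permutation
  -- are fixed by the other. Together with `commutator_apply_eq_self` for the remaining points, this
  -- determines the commutator.
  have hτσ : τ (σ p) = σ p := (h _ hσ).resolve_left fun e => hσ (σ.injective e)
  have hστ : σ (τ p) = τ p := (h _ hτ).resolve_right fun e => hτ (τ.injective e)
  have hne : σ p ≠ τ p := fun e => hσ (σ.injective (by rw [e, hστ]))
  have hσi : σ⁻¹ p ≠ p := fun e => hσ (Perm.inv_eq_iff_eq.1 e).symm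
  have hτi : τ⁻¹ p ≠ p := fun e => hτ (Perm.inv_eq_iff_eq.1 e).symm
  have h1 : σ (τ⁻¹ p) = τ⁻¹ p :=
    (h _ hτi).resolve_right fun e => hτi (by rw [Perm.apply_inv_self'] at e; exact e.symm)
  have h2 : τ (σ⁻¹ p) = σ⁻¹ p :=
    (h _ hσi).resolve_left fun e => hσi (by rw [Perm.apply_inv_self'] at e; exact e.symm)
  refine ⟨hne, ?_⟩
  ext x : 1
  by_cases hxp : x = p
  · subst hxp
    have e1 : σ⁻¹ (τ⁻¹ x) = τ⁻¹ x := Perm.inv_eq_iff_eq.2 h1.symm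
    rw [commutatorElement_def, Perm.mul_apply, Perm.mul_apply, Perm.mul_apply, e1,
      Perm.apply_inv_self', Perm.mul_apply, swap_apply_of_ne_of_ne hσ.symm hτ.symm,
      swap_apply_left]
  by_cases hxσ : x = σ p
  · subst hxσ
    have e1 : τ⁻¹ (σ p) = σ p := Perm.inv_eq_iff_eq.2 hτσ.symm
    simp [commutatorElement_def, Perm.mul_apply, e1, hστ, swap_apply_of_ne_of_ne hτ hne.symm]
  by_cases hxτ : x = τ p
  · subst hxτ
    rw [commutatorElement_def, Perm.mul_apply, Perm.mul_apply, Perm.mul_apply,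
      Perm.inv_apply_self', h2, Perm.apply_inv_self', Perm.mul_apply, swap_apply_right,
      swap_apply_right]
  rw [commutator_apply_eq_self σ τ x (h _ hxp)
    (h _ fun e => hxσ (Perm.inv_eq_iff_eq.1 e)) (h _ fun e => hxτ (Perm.inv_eq_iff_eq.1 e)),
    Perm.mul_apply, swap_apply_of_ne_of_ne hxσ hxτ, swap_apply_of_ne_of_ne hxp hxσ]

/-! ### Turns as permutations -/

variable {n k : ℕ}

theorem rotatePos_apply_of_ne {i j l : Fin n} (hi : l ≠ i) (hj : l ≠ j) (p : CubiePos n k) :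
    rotatePos i j p l = p l := by
  simp [rotatePos, hi, hj]

theorem rotatePos_apply_left (i j : Fin n) (p : CubiePos n k) :
    rotatePos i j p i = (p j).rev := by
  simp [rotatePos]

theorem rotatePos_apply_right {i j : Fin n} (hij : i ≠ j) (p : CubiePos n k) :
    rotatePos i j p j = p i := by
  simp [rotatePos, hij.symm]

theorem rotatePos_rotatePos_swap {i j : Fin n} (hij : i ≠ j) (p : CubiePos n k) :
    rotatePos j i (rotatePos i j p) = p := by
  funext l
  by_cases hj : l = j
  · subst hj
    rw [rotatePos_apply_left, rotatePos_apply_left, Fin.rev_rev]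
  by_cases hi : l = i
  · subst hi
    rw [rotatePos_apply_right hij.symm, rotatePos_apply_right hij]
  rw [rotatePos_apply_of_ne hj hi, rotatePos_apply_of_ne hi hj]

theorem rotateFace_rotateFace_swap {i j : Fin n} (hij : i ≠ j) (f : FacePos n k) :
    rotateFace j i (rotateFace i j f) = f := by
  apply FacePos.ext
  · exact rotatePos_rotatePos_swap hij f.cubie
  · ext l
    simp [rotateFace, Finset.mem_map_equiv, swap_comm j i]

theorem IsMiddleIndex.rev_eq {a : Fin k} (h : IsMiddleIndex a) : a.rev = a := by
  unfold IsMiddleIndex at h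
  ext
  rw [Fin.val_rev]
  omega

theorem isMiddleIndex_of_rev_eq {a : Fin k} (h : a.rev = a) : IsMiddleIndex a := by
  unfold IsMiddleIndex
  have := congrArg Fin.val h
  rw [Fin.val_rev] at this
  omega

theorem isMiddleIndex_unique {a b : Fin k} (ha : IsMiddleIndex a) (hb : IsMiddleIndex b) :
    a = b := by
  unfold IsMiddleIndex at *
  ext
  omega

/-- A quarter turn of a square fixes only its central cell, and there is none when `k` is even. -/
theorem rotatePos_eq_self_iff {i j : Fin n} (hij : i ≠ j) (p : CubiePos n k) :
    rotatePos i j p = p ↔ IsMiddleIndex (p i) ∧ IsMiddleIndex (p j) := by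
  constructor
  · intro h
    have hi := congrFun h i
    have hj := congrFun h j
    rw [rotatePos_apply_left] at hi
    rw [rotatePos_apply_right hij] at hj
    rw [hj]
    exact ⟨isMiddleIndex_of_rev_eq (hi.trans hj), isMiddleIndex_of_rev_eq (hi.trans hj)⟩
  · rintro ⟨hi, hj⟩
    have e := isMiddleIndex_unique hi hj
    funext l
    by_cases h1 : l = i
    · subst h1
      rw [rotatePos_apply_left, hj.rev_eq, e]
    by_cases h2 : l = j
    · subst h2
      rw [rotatePos_apply_right hij, e]
    rw [rotatePos_apply_of_ne h1 h2]

theorem Layer.contains_rotatePos {L : Layer n k} {i j : Fin n} (hi : i ∈ L.free)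
    (hj : j ∈ L.free) (p : CubiePos n k) : L.Contains (rotatePos i j p) ↔ L.Contains p := by
  refine forall₂_congr fun l hl => ?_
  have h1 : l ≠ i := fun e => hl (e ▸ hi)
  have h2 : l ≠ j := fun e => hl (e ▸ hj)
  rw [rotatePos_apply_of_ne h1 h2]

/-- The inverse turn. -/
def LayerTurn.symm (t : LayerTurn n k) : LayerTurn n k :=
  ⟨t.layer, t.j, t.i, t.j_mem, t.i_mem, t.i_ne_j.symm⟩

theorem LayerTurn.symm_movePos_movePos (t : LayerTurn n k) (p : CubiePos n k) :
    t.symm.movePos (t.movePos p) = p := by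
  by_cases h : t.layer.Contains p
  · have h' := (Layer.contains_rotatePos t.i_mem t.j_mem p).2 h
    simp [LayerTurn.movePos, LayerTurn.symm, h, h', rotatePos_rotatePos_swap t.i_ne_j]
  · simp [LayerTurn.movePos, LayerTurn.symm, h]

theorem LayerTurn.symm_moveFace_moveFace (t : LayerTurn n k) (f : FacePos n k) :
    t.symm.moveFace (t.moveFace f) = f := by
  by_cases h : t.layer.Contains f.cubie
  · have h' : t.layer.Contains (rotateFace t.i t.j f).cubie :=
      (Layer.contains_rotatePos t.i_mem t.j_mem f.cubie).2 h
    simp [LayerTurn.moveFace, LayerTurn.symm, h, h', rotateFace_rotateFace_swap t.i_ne_j]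
  · simp [LayerTurn.moveFace, LayerTurn.symm, h]

theorem LayerTurn.cubie_moveFace (t : LayerTurn n k) (f : FacePos n k) :
    (t.moveFace f).cubie = t.movePos f.cubie := by
  by_cases h : t.layer.Contains f.cubie <;> simp [LayerTurn.moveFace, LayerTurn.movePos, h, rotateFace]

/-- The permutations of cubies and of faces effected by a turn. -/
def LayerTurn.perm (t : LayerTurn n k) : Perm (CubiePos n k) × Perm (FacePos n k) :=
  (⟨t.movePos, t.symm.movePos, t.symm_movePos_movePos, t.symm.symm_movePos_movePos⟩,
   ⟨t.moveFace, t.symm.moveFace, t.symm_moveFace_moveFace, t.symm.symm_moveFace_moveFace⟩)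

/-- The group generated by all turns. -/
def turnGroup (n k : ℕ) : Subgroup (Perm (CubiePos n k) × Perm (FacePos n k)) :=
  Subgroup.closure (Set.range LayerTurn.perm)

theorem LayerTurn.perm_mem (t : LayerTurn n k) : t.perm ∈ turnGroup n k :=
  Subgroup.subset_closure ⟨t, rfl⟩

theorem Combination.movePos_append (v w : Combination n k) (p : CubiePos n k) :
    Combination.movePos (v ++ w) p = w.movePos (v.movePos p) := List.foldl_append

theorem Combination.moveFace_append (v w : Combination n k) (f : FacePos n k) :
    Combination.moveFace (v ++ w) f = w.moveFace (v.moveFace f) := List.foldl_append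

theorem exists_combination_of_mem_turnGroup {g : Perm (CubiePos n k) × Perm (FacePos n k)}
    (hg : g ∈ turnGroup n k) :
    ∃ w : Combination n k, (∀ p, w.movePos p = g.1 p) ∧ ∀ f, w.moveFace f = g.2 f := by
  induction hg using Subgroup.closure_induction'' with
  | mem x hx =>
    obtain ⟨t, rfl⟩ := hx
    exact ⟨[t], fun _ => rfl, fun _ => rfl⟩
  | inv_mem x hx =>
    obtain ⟨t, rfl⟩ := hx
    exact ⟨[t.symm], fun _ => rfl, fun _ => rfl⟩
  | one => exact ⟨[], fun _ => rfl, fun _ => rfl⟩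
  | mul x y _ _ hx hy =>
    obtain ⟨v, hv⟩ := hx
    obtain ⟨w, hw⟩ := hy
    -- The order is reversed: the product `x * y` applies `y` first, a combination its head.
    refine ⟨w ++ v, fun p => ?_, fun f => ?_⟩
    · rw [Combination.movePos_append, hw.1, hv.1]; rfl
    · rw [Combination.moveFace_append, hw.2, hv.2]; rfl

theorem exists_mem_turnGroup_of_combination (w : Combination n k) :
    ∃ g ∈ turnGroup n k, ∀ p, w.movePos p = g.1 p := by
  induction w with
  | nil => exact ⟨1, one_mem _, fun _ => rfl⟩
  | cons t w ih =>
    obtain ⟨g, hg, h⟩ := ih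
    exact ⟨g * t.perm, mul_mem hg t.perm_mem, fun p => h (t.movePos p)⟩

/-- Faces travel with their cubies. Hence the face with `pinned = ∅`, the cubie itself, turns
statements about faces into statements about positions. -/
theorem cubie_snd_apply {g : Perm (CubiePos n k) × Perm (FacePos n k)}
    (hg : g ∈ turnGroup n k) (f : FacePos n k) : (g.2 f).cubie = g.1 f.cubie := by
  obtain ⟨w, h1, h2⟩ := exists_combination_of_mem_turnGroup hg
  rw [← h1, ← h2]
  clear h1 h2
  induction w generalizing f with
  | nil => rfl
  | cons t w ih => exact (ih (t.moveFace f)).trans (congrArg _ (t.cubie_moveFace f))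

theorem linked_iff_exists_mem_turnGroup {p q : CubiePos n k} :
    Linked p q ↔ ∃ g ∈ turnGroup n k, g.1 p = q := by
  constructor
  · rintro ⟨w, rfl⟩
    obtain ⟨g, hg, h⟩ := exists_mem_turnGroup_of_combination w
    exact ⟨g, hg, (h p).symm⟩
  · rintro ⟨g, hg, rfl⟩
    obtain ⟨w, h, -⟩ := exists_combination_of_mem_turnGroup hg
    exact ⟨w, h p⟩

theorem Linked.symm {p q : CubiePos n k} (h : Linked p q) : Linked q p := by
  rw [linked_iff_exists_mem_turnGroup] at *
  obtain ⟨g, hg, rfl⟩ := h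
  exact ⟨g⁻¹, inv_mem hg, Perm.inv_apply_self' _ _⟩

theorem Linked.trans {p q r : CubiePos n k} (h : Linked p q) (h' : Linked q r) : Linked p r := by
  obtain ⟨v, rfl⟩ := h
  obtain ⟨w, rfl⟩ := h'
  exact ⟨v ++ w, Combination.movePos_append v w p⟩

/-- A property of positions which is kept by all quarter turns of the cube is kept by links. -/
theorem Linked.of_rotatePos {P : CubiePos n k → Prop}
    (hP : ∀ i j p, i ≠ j → P p → P (rotatePos i j p)) {p q : CubiePos n k} (h : Linked p q)
    (hp : P p) : P q := by
  obtain ⟨w, rfl⟩ := h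
  induction w generalizing p with
  | nil => exact hp
  | cons t w ih =>
    refine ih (p := t.movePos p) ?_
    unfold LayerTurn.movePos
    split
    · exact hP _ _ _ t.i_ne_j hp
    · exact hp

/-! ### Turns of two-dimensional layers -/

/-- The turn in the plane `i`, `j` of the two-dimensional layer through `p`. -/
def planeTurn (p : CubiePos n k) (i j : Fin n) (hij : i ≠ j) : LayerTurn n k :=
  ⟨⟨{i, j}, p⟩, i, j, by simp, by simp, hij⟩

theorem planeTurn_contains {p q : CubiePos n k} {i j : Fin n} {hij : i ≠ j} :
    (planeTurn p i j hij).layer.Contains q ↔ ∀ l, l ≠ i → l ≠ j → q l = p l := by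
  simp [planeTurn, Layer.Contains]

theorem planeTurn_movePos_self (p : CubiePos n k) (i j : Fin n) (hij : i ≠ j) :
    (planeTurn p i j hij).movePos p = rotatePos i j p := by
  rw [LayerTurn.movePos, if_pos (planeTurn_contains.2 fun _ _ _ => rfl)]
  rfl

theorem linked_rotatePos (p : CubiePos n k) {i j : Fin n} (hij : i ≠ j) :
    Linked p (rotatePos i j p) :=
  ⟨[planeTurn p i j hij], planeTurn_movePos_self p i j hij⟩

theorem LayerTurn.moveFace_of_not_contains {t : LayerTurn n k} {f : FacePos n k}
    (h : ¬ t.layer.Contains f.cubie) : t.moveFace f = f := if_neg h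

/-- If `U` is a turn of a two-dimensional layer through `p` in a plane spanned by `j` and another
coordinate `l ≠ i`, which changes the coordinate `l` of `p` and in which the new coordinate `l`
determines the old coordinate `j`, then conjugating by `U` the turn in the plane `i`, `j` through
`U p` gives a motion which shares with the turn in the plane `i`, `j` through `p` only the
cubie `p`. -/
theorem planeTurn_disjoint_conj {p : CubiePos n k} {i j l : Fin n} (hij : i ≠ j) (hli : l ≠ i)
    (hlj : l ≠ j) (U : LayerTurn n k)
    (hU : ∀ q, U.layer.Contains q ↔ ∀ m, m ≠ j → m ≠ l → q m = p m)
    (hUp : U.movePos p l ≠ p l)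
    (hUinj : ∀ q, U.layer.Contains q → U.movePos q l = U.movePos p l → q j = p j)
    (f : FacePos n k) (hf : f.cubie ≠ p) :
    (planeTurn p i j hij).perm.2 f = f ∨
      (U.perm⁻¹ * (planeTurn (U.movePos p) i j hij).perm * U.perm).2 f = f := by
  by_cases hA : (planeTurn p i j hij).layer.Contains f.cubie
  swap
  · exact Or.inl (LayerTurn.moveFace_of_not_contains hA)
  right
  rw [planeTurn_contains] at hA
  have key : (planeTurn (U.movePos p) i j hij).moveFace (U.moveFace f) = U.moveFace f := by
    apply LayerTurn.moveFace_of_not_contains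
    rw [planeTurn_contains, LayerTurn.cubie_moveFace]
    intro h
    have hl := h l hli hlj
    -- The cubie of `f` lies in the layer of the first turn, and its image under `U` in the layer
    -- through `U p`. If `U` moves its layer, coordinate `l` of the image recovers coordinate `j`,
    -- and coordinate `i` is prescribed by the layer of `U`, so the cubie is `p`. If not, `l` keeps
    -- its old value `p l`, which `U` changes for `p`.
    by_cases hc : U.layer.Contains f.cubie
    · have hj := hUinj _ hc hl
      apply hf
      funext m
      by_cases hmi : m = i
      · subst hmi
        exact (hU _).1 hc m hij hli.symm
      by_cases hmj : m = j
      · rw [hmj, hj]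
      exact hA m hmi hmj
    · rw [LayerTurn.movePos, if_neg hc, hA l hli hlj] at hl
      exact hUp hl.symm
  change U.perm⁻¹.2 ((planeTurn (U.movePos p) i j hij).moveFace (U.moveFace f)) = f
  rw [key]
  exact U.symm_moveFace_moveFace f

/-- If the coordinate `l` differs from `i`, `j` and the cubie `p` is in middle position neither in
both `i`, `l` nor in both `j`, `l`, then some motion moves `p` and shares with the turn in the
plane `i`, `j` only the cubie `p`. -/
theorem exists_disjoint_motion {p : CubiePos n k} {i j l : Fin n} (hij : i ≠ j) (hli : l ≠ i)
    (hlj : l ≠ j) (hil : ¬ (IsMiddleIndex (p i) ∧ IsMiddleIndex (p l)))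
    (hjl : ¬ (IsMiddleIndex (p j) ∧ IsMiddleIndex (p l))) :
    ∃ h ∈ turnGroup n k, h.1 p ≠ p ∧
      ∀ f : FacePos n k, f.cubie ≠ p → (planeTurn p i j hij).perm.2 f = f ∨ h.2 f = f := by
  have main : ∀ U : LayerTurn n k,
      (∀ q, U.layer.Contains q ↔ ∀ m, m ≠ j → m ≠ l → q m = p m) →
      U.movePos p l ≠ p l →
      (∀ q, U.layer.Contains q → U.movePos q l = U.movePos p l → q j = p j) →
      (IsMiddleIndex (U.movePos p j) → IsMiddleIndex (p l)) → U.movePos p i = p i →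
      ∃ h ∈ turnGroup n k, h.1 p ≠ p ∧
        ∀ f : FacePos n k, f.cubie ≠ p → (planeTurn p i j hij).perm.2 f = f ∨ h.2 f = f := by
    intro U hU hUp hUinj hm hi
    refine ⟨U.perm⁻¹ * (planeTurn (U.movePos p) i j hij).perm * U.perm,
      mul_mem (mul_mem (inv_mem U.perm_mem) (LayerTurn.perm_mem _)) U.perm_mem, ?_,
      planeTurn_disjoint_conj hij hli hlj U hU hUp hUinj⟩
    -- The conjugate fixes `p` only if the turn through `U p` fixes `U p`, which needs middle
    -- indices in `i` and `j`; these would come from middle `p i` and `p l`.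
    intro h
    have h' : (planeTurn (U.movePos p) i j hij).movePos (U.movePos p) = U.movePos p :=
      (Perm.inv_eq_iff_eq (f := U.perm.1)).1 h
    rw [planeTurn_movePos_self, rotatePos_eq_self_iff hij, hi] at h'
    exact hil ⟨h'.1, hm h'.2⟩
  -- The direction of `U` is chosen so that coordinate `l` changes: its new value is `(p j).rev` in
  -- the first case, where `hjl` excludes a middle index, and `p j` in the second.
  by_cases e : p j = p l
  · refine main (planeTurn p l j hlj) (fun q => ?_) ?_ ?_ ?_ ?_
    · rw [planeTurn_contains]
      exact ⟨fun h m h1 h2 => h m h2 h1, fun h m h1 h2 => h m h2 h1⟩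
    · rw [planeTurn_movePos_self, rotatePos_apply_left, ← e]
      intro h
      have := isMiddleIndex_of_rev_eq h
      exact hjl ⟨this, e ▸ this⟩
    · intro q hq
      rw [planeTurn_movePos_self, rotatePos_apply_left, LayerTurn.movePos, if_pos hq]
      change rotatePos l j q l = _ → _
      rw [rotatePos_apply_left]
      exact fun h => Fin.rev_injective h
    · rw [planeTurn_movePos_self, rotatePos_apply_right hlj]
      exact id
    · rw [planeTurn_movePos_self, rotatePos_apply_of_ne hli.symm hij]
  · refine main (planeTurn p j l hlj.symm) (fun q => planeTurn_contains) ?_ ?_ ?_ ?_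
    · rwa [planeTurn_movePos_self, rotatePos_apply_right hlj.symm]
    · intro q hq
      rw [planeTurn_movePos_self, rotatePos_apply_right hlj.symm, LayerTurn.movePos, if_pos hq]
      change rotatePos j l q l = _ → _
      rw [rotatePos_apply_right hlj.symm]
      exact id
    · rw [planeTurn_movePos_self, rotatePos_apply_left]
      intro h
      have := h.rev_eq
      rw [Fin.rev_rev] at this
      rwa [this]
    · rw [planeTurn_movePos_self, rotatePos_apply_of_ne hij hli.symm]

/-! ### The frame -/

theorem not_isMiddleIndex_of_isBoundaryIndex (hk : 2 ≤ k) {a : Fin k} (h : IsBoundaryIndex a) :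
    ¬ IsMiddleIndex a := by
  unfold IsBoundaryIndex at h
  unfold IsMiddleIndex
  omega

theorem IsMiddleIndex.rev {a : Fin k} (h : IsMiddleIndex a) : IsMiddleIndex a.rev := by
  rwa [h.rev_eq]

theorem IsOuter.rotatePos {i j : Fin n} (hij : i ≠ j) {p : CubiePos n k} (h : IsOuter p) :
    IsOuter (rotatePos i j p) := by
  obtain ⟨l, hl⟩ := h
  simp only [boundaryCoords, Finset.mem_filter, Finset.mem_univ, true_and] at hl
  suffices ∃ m, IsBoundaryIndex (_root_.rotatePos i j p m) by
    obtain ⟨m, hm⟩ := this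
    exact ⟨m, by simpa [boundaryCoords] using hm⟩
  by_cases hi : l = i
  · subst hi
    exact ⟨j, by rwa [rotatePos_apply_right hij]⟩
  by_cases hj : l = j
  · subst hj
    exact ⟨i, by rw [rotatePos_apply_left]; exact hl.rev⟩
  exact ⟨l, by rwa [rotatePos_apply_of_ne hi hj]⟩

theorem IsFramePos.rotatePos {i j : Fin n} (hij : i ≠ j) {p : CubiePos n k} (h : IsFramePos p) :
    IsFramePos (rotatePos i j p) := by
  obtain ⟨l, hl, hmid⟩ := h
  refine ⟨swap i j l, ?_, fun m hm => ?_⟩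
  · by_cases hi : l = i
    · subst hi
      rwa [swap_apply_left, rotatePos_apply_right hij]
    by_cases hj : l = j
    · subst hj
      rw [swap_apply_right, rotatePos_apply_left]
      exact hl.rev
    rwa [swap_apply_of_ne_of_ne hi hj, rotatePos_apply_of_ne hi hj]
  · have hm' : swap i j m ≠ l := fun e => hm (by rw [← e, swap_apply_self])
    have h := hmid _ hm'
    by_cases hi : m = i
    · subst hi
      rw [rotatePos_apply_left]
      rw [swap_apply_left] at h
      exact h.rev
    by_cases hj : m = j
    · subst hj
      rw [rotatePos_apply_right hij]
      rwa [swap_apply_right] at h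
    rw [rotatePos_apply_of_ne hi hj]
    rwa [swap_apply_of_ne_of_ne hi hj] at h

theorem linked_of_framePos_of_ne {p q : CubiePos n k} {i j : Fin n} (hij : i ≠ j)
    (hpi : IsBoundaryIndex (p i)) (hp : ∀ l, l ≠ i → IsMiddleIndex (p l))
    (hqj : IsBoundaryIndex (q j)) (hq : ∀ l, l ≠ j → IsMiddleIndex (q l)) : Linked p q := by
  have hcase : q j = p i ∨ q j = (p i).rev := by
    unfold IsBoundaryIndex at hpi hqj
    simp only [Fin.ext_iff, Fin.val_rev]
    omega
  -- One quarter turn suffices: `rotatePos i j` puts `p i` in coordinate `j`, the opposite turn puts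
  -- `(p i).rev` there.
  rcases hcase with h | h
  · have : rotatePos i j p = q := by
      funext l
      by_cases hi : l = i
      · subst hi
        rw [rotatePos_apply_left]
        exact isMiddleIndex_unique (hp j hij.symm).rev (hq l hij)
      by_cases hj : l = j
      · subst hj
        rw [rotatePos_apply_right hij, h]
      rw [rotatePos_apply_of_ne hi hj]
      exact isMiddleIndex_unique (hp l hi) (hq l hj)
    exact this ▸ linked_rotatePos p hij
  · have : rotatePos j i p = q := by
      funext l
      by_cases hj : l = j
      · subst hj
        rw [rotatePos_apply_left, h]
      by_cases hi : l = i
      · subst hi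
        rw [rotatePos_apply_right hij.symm]
        exact isMiddleIndex_unique (hp j hij.symm) (hq l hij)
      rw [rotatePos_apply_of_ne hj hi]
      exact isMiddleIndex_unique (hp l hi) (hq l hj)
    exact this ▸ linked_rotatePos p hij.symm

theorem IsFramePos.linked (hn : 2 ≤ n) {p q : CubiePos n k} (hp : IsFramePos p)
    (hq : IsFramePos q) : Linked p q := by
  obtain ⟨i, hpi, hp⟩ := hp
  obtain ⟨j, hqj, hq⟩ := hq
  by_cases hij : i = j
  -- With a common axis, a preliminary turn brings the boundary index to another axis `m`.
  · subst hij
    have : Nontrivial (Fin n) := Fin.nontrivial_iff_two_le.2 hn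
    obtain ⟨m, hm⟩ := exists_ne i
    have hr := linked_rotatePos p hm.symm
    refine hr.trans (linked_of_framePos_of_ne hm ?_ (fun l hl => ?_) hqj hq)
    · rwa [rotatePos_apply_right hm.symm]
    · by_cases hli : l = i
      · subst hli
        rw [rotatePos_apply_left]
        exact (hp m hm).rev
      · rw [rotatePos_apply_of_ne hli hl]
        exact hp l hli
  · exact linked_of_framePos_of_ne hij hpi hp hqj hq

/-- A class which is not the frame contains no frame position. -/
theorem IsCubieClass.not_isFramePos (hn : 2 ≤ n) {C : Finset (CubiePos n k)}
    (hC : IsCubieClass C) (hframe : ¬ IsFrame C) {p : CubiePos n k} (hp : p ∈ C) :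
    ¬ IsFramePos p := by
  obtain ⟨p₀, -, h⟩ := hC
  intro hpf
  refine hframe fun q => ⟨fun hq => ?_, fun hq => ?_⟩
  · exact (((h p).1 hp).symm.trans ((h q).1 hq)).of_rotatePos
      (fun _ _ _ hij hr => hr.rotatePos hij) hpf
  · exact (h q).2 (((h p).1 hp).trans (hpf.linked hn hq))

theorem IsCubieClass.isOuter {C : Finset (CubiePos n k)} (hC : IsCubieClass C)
    {p : CubiePos n k} (hp : p ∈ C) : IsOuter p := by
  obtain ⟨p₀, h₀, h⟩ := hC
  exact ((h p).1 hp).of_rotatePos (fun _ _ _ hij hr => hr.rotatePos hij) h₀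

theorem IsCubieClass.mem_of_linked {C : Finset (CubiePos n k)} (hC : IsCubieClass C)
    {p q : CubiePos n k} (hp : p ∈ C) (h : Linked p q) : q ∈ C := by
  obtain ⟨p₀, -, h₀⟩ := hC
  exact (h₀ q).2 (((h₀ p).1 hp).trans h)

theorem IsCubieClass.linked {C : Finset (CubiePos n k)} (hC : IsCubieClass C)
    {p q : CubiePos n k} (hp : p ∈ C) (hq : q ∈ C) : Linked p q := by
  obtain ⟨p₀, -, h₀⟩ := hC
  exact ((h₀ p).1 hp).symm.trans ((h₀ q).1 hq)

/-- For an outer cubie which is not in a frame position and for any coordinates `i`, `j` there is a third coordinate suitable for `exists_disjoint_motion`. -/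
theorem exists_third_coordinate (hn : 3 ≤ n) (hk : 2 ≤ k) {p : CubiePos n k} (ho : IsOuter p)
    (hf : ¬ IsFramePos p) (i j : Fin n) :
    ∃ l, l ≠ i ∧ l ≠ j ∧ ¬ (IsMiddleIndex (p i) ∧ IsMiddleIndex (p l)) ∧
      ¬ (IsMiddleIndex (p j) ∧ IsMiddleIndex (p l)) := by
  obtain ⟨m, hmb⟩ := ho
  simp only [boundaryCoords, Finset.mem_filter, Finset.mem_univ, true_and] at hmb
  have hmm := not_isMiddleIndex_of_isBoundaryIndex hk hmb
  by_cases hl : ∃ l, l ≠ i ∧ l ≠ j ∧ ¬ IsMiddleIndex (p l)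
  · obtain ⟨l, h1, h2, h3⟩ := hl
    exact ⟨l, h1, h2, fun h => h3 h.2, fun h => h3 h.2⟩
  push Not at hl
  -- All indices outside `i`, `j` are now middle. If `p i` were middle too, the boundary coordinate
  -- could only be `j`, and `p` would be a frame position.
  have hi : ¬ IsMiddleIndex (p i) := fun hi => hf ⟨m, hmb, fun l hlm => by
    by_contra hc
    have hlj : l = j := by
      by_contra hlj
      exact hc (hl l (fun e => hc (e ▸ hi)) hlj)
    have hmj : m = j := by
      by_contra hmj
      exact hmm (hl m (fun e => hmm (e ▸ hi)) hmj)
    exact hlm (hlj.trans hmj.symm)⟩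
  have hj : ¬ IsMiddleIndex (p j) := fun hj => hf ⟨m, hmb, fun l hlm => by
    by_contra hc
    have hlj : l = i := by
      by_contra hlj
      exact hc (hl l hlj (fun e => hc (e ▸ hj)))
    have hmj : m = i := by
      by_contra hmj
      exact hmm (hl m hmj (fun e => hmm (e ▸ hj)))
    exact hlm (hlj.trans hmj.symm)⟩
  obtain ⟨l, hlij⟩ : ∃ l, l ∉ ({i, j} : Finset (Fin n)) := by
    by_contra! h
    have h1 := Finset.card_le_card (fun l _ => h l : Finset.univ ⊆ ({i, j} : Finset (Fin n)))
    have h2 := Finset.card_le_two (a := i) (b := j)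
    rw [Finset.card_univ, Fintype.card_fin] at h1
    omega
  simp only [Finset.mem_insert, Finset.mem_singleton, not_or] at hlij
  exact ⟨l, hlij.1, hlij.2, fun h => hi h.1, fun h => hj h.1⟩

/-! ### Careful permutations -/

/-- The permutations of `C` which can be carried out without moving any face of a cubie
outside `C`. -/
def carefulSubgroup (C : Finset (CubiePos n k)) : Subgroup (Perm C) where
  carrier := {π | ∃ g ∈ turnGroup n k, (∀ p : C, g.1 p = π p) ∧ ∀ f, f.cubie ∉ C → g.2 f = f}
  one_mem' := ⟨1, one_mem _, fun _ => rfl, fun _ _ => rfl⟩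
  mul_mem' := by
    rintro π ρ ⟨g, hg, h1, h2⟩ ⟨h, hh, h3, h4⟩
    refine ⟨g * h, mul_mem hg hh, fun p => ?_, fun f hf => ?_⟩
    · exact (congrArg g.1 (h3 p)).trans (h1 (ρ p))
    · exact (congrArg g.2 (h4 f hf)).trans (h2 f hf)
  inv_mem' := by
    rintro π ⟨g, hg, h1, h2⟩
    refine ⟨g⁻¹, inv_mem hg, fun p => ?_, fun f hf => ?_⟩
    · exact Perm.inv_eq_iff_eq.2 (by rw [h1, Perm.apply_inv_self'])
    · exact Perm.inv_eq_iff_eq.2 (h2 f hf).symm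

theorem exists_combination_of_mem_carefulSubgroup {C : Finset (CubiePos n k)} {π : Perm C}
    (h : π ∈ carefulSubgroup C) : ∃ w : Combination n k, w.CarefullyRealises π := by
  obtain ⟨g, hg, h1, h2⟩ := h
  obtain ⟨w, hw1, hw2⟩ := exists_combination_of_mem_turnGroup hg
  refine ⟨w, fun p => (hw1 p).trans (h1 p), fun p hp => ⟨?_, fun f hf _ => ?_⟩⟩
  · have h := congrArg FacePos.cubie (h2 ⟨p, ∅, by simp⟩ hp)
    rw [cubie_snd_apply hg] at h
    exact (hw1 p).trans h
  · exact (hw2 f).trans (h2 f (hf ▸ hp))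

/-- A quarter turn which moves a cubie of a class other than the frame extends to a careful
three-cycle. -/
theorem exists_threeCycle_mem_carefulSubgroup (hn : 3 ≤ n) (hk : 2 ≤ k)
    {C : Finset (CubiePos n k)} (hC : IsCubieClass C) (hframe : ¬ IsFrame C) (a b : C)
    (hab : a ≠ b) {i j : Fin n} (hij : i ≠ j) (h : b.1 = rotatePos i j a.1) :
    ∃ c, a ≠ b ∧ a ≠ c ∧ b ≠ c ∧ swap a b * swap b c ∈ carefulSubgroup C := by
  obtain ⟨p, hp⟩ := a
  obtain ⟨q, hq⟩ := b
  dsimp only at h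
  subst h
  have hne : rotatePos i j p ≠ p := fun e => hab (Subtype.ext e.symm)
  obtain ⟨l, hli, hlj, hil, hjl⟩ := exists_third_coordinate hn hk (hC.isOuter hp)
    (hC.not_isFramePos (by omega) hframe hp) i j
  obtain ⟨h, hh, hhp, hdisj⟩ := exists_disjoint_motion hij hli hlj hil hjl
  set g := (planeTurn p i j hij).perm with hg_def
  have hg : g ∈ turnGroup n k := LayerTurn.perm_mem _
  have hgp : g.1 p = rotatePos i j p := planeTurn_movePos_self p i j hij
  have hpos : ∀ x, x ≠ p → g.1 x = x ∨ h.1 x = x := by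
    intro x hx
    refine (hdisj ⟨x, ∅, by simp⟩ hx).imp (fun e => ?_) (fun e => ?_)
    · simpa only [cubie_snd_apply hg] using congrArg FacePos.cubie e
    · simpa only [cubie_snd_apply hh] using congrArg FacePos.cubie e
  obtain ⟨hne', hcomm⟩ := commutator_eq_threeCycle g.1 h.1 p (by rwa [hgp]) hhp hpos
  rw [hgp] at hne' hcomm
  have hhC : h.1 p ∈ C :=
    hC.mem_of_linked hp (linked_iff_exists_mem_turnGroup.2 ⟨h, hh, rfl⟩)
  refine ⟨⟨h.1 p, hhC⟩, hab, fun e => hhp (congrArg Subtype.val e).symm,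
    fun e => hne' (congrArg Subtype.val e), ⁅g, h⁆, ?_, fun x => ?_, fun f hf => ?_⟩
  · exact mul_mem (mul_mem (mul_mem hg hh) (inv_mem hg)) (inv_mem hh)
  · change ⁅g.1, h.1⁆ x.1 = _
    rw [hcomm]
    simp only [Perm.mul_apply, swap_apply_def, Subtype.ext_iff, apply_ite Subtype.val]
  -- The inverse images of `f` under `g` and `h` stay outside `C`, hence away from `p`, so neither
  -- they nor `f` are moved by both motions.
  · have hcub : ∀ u ∈ turnGroup n k, (u⁻¹.2 f).cubie ∉ C := by
      intro u hu hc
      rw [cubie_snd_apply (inv_mem hu)] at hc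
      refine hf (hC.mem_of_linked hc (linked_iff_exists_mem_turnGroup.2 ⟨u, hu, ?_⟩))
      exact Perm.apply_inv_self' _ _
    have hoff : ∀ f' : FacePos n k, f'.cubie ∉ C → g.2 f' = f' ∨ h.2 f' = f' :=
      fun f' hf' => hdisj f' fun e => hf' (e ▸ hp)
    exact commutator_apply_eq_self g.2 h.2 f (hoff f hf) (hoff _ (hcub g hg)) (hoff _ (hcub h hh))

theorem IsCubieClass.nontrivial (hn : 2 ≤ n) (hk : 2 ≤ k) {C : Finset (CubiePos n k)}
    (hC : IsCubieClass C) : Nontrivial C := by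
  obtain ⟨p, hp⟩ : ∃ p, p ∈ C := by
    obtain ⟨p₀, -, h⟩ := hC
    exact ⟨p₀, (h p₀).2 ⟨[], rfl⟩⟩
  obtain ⟨i, hi⟩ := hC.isOuter hp
  simp only [boundaryCoords, Finset.mem_filter, Finset.mem_univ, true_and] at hi
  have : Nontrivial (Fin n) := Fin.nontrivial_iff_two_le.2 hn
  obtain ⟨j, hj⟩ := exists_ne i
  refine ⟨⟨p, hp⟩, ⟨rotatePos i j p, hC.mem_of_linked hp (linked_rotatePos p hj.symm)⟩, ?_⟩
  intro e
  exact not_isMiddleIndex_of_isBoundaryIndex hk hi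
    ((rotatePos_eq_self_iff hj.symm p).1 (congrArg Subtype.val e).symm).1

theorem mainTheorem2 (n k : ℕ) (hn : 3 ≤ n) (hk : 2 ≤ k) (C : Finset (CubiePos n k))
    (hC : IsCubieClass C) (hframe : ¬ IsFrame C) (π : Equiv.Perm C)
    (hπ : Equiv.Perm.sign π = 1) :
    ∃ w : Combination n k, w.CarefullyRealises π := by
  apply exists_combination_of_mem_carefulSubgroup
  have := hC.nontrivial (by omega) hk
  refine alternatingGroup_le_of_connected_threeCycles (carefulSubgroup C)
    (fun a b => a ≠ b ∧ ∃ i j, i ≠ j ∧ b.1 = rotatePos i j a.1) ?_ ?_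
    (Equiv.Perm.mem_alternatingGroup.2 hπ)
  · rintro a b ⟨hab, i, j, hij, h⟩
    exact exists_threeCycle_mem_carefulSubgroup hn hk hC hframe a b hab hij h
  · intro a b
    obtain ⟨hb, h⟩ := (hC.linked a.2 b.2).of_rotatePos
      (P := fun q => ∃ hq : q ∈ C, Relation.ReflTransGen
        (fun a b : C => a ≠ b ∧ ∃ i j, i ≠ j ∧ b.1 = rotatePos i j a.1) a ⟨q, hq⟩)
      (fun i j p hij hp => by
        obtain ⟨hp, h⟩ := hp
        refine ⟨hC.mem_of_linked hp (linked_rotatePos p hij), ?_⟩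
        -- A turn that fixes `p` gives no edge, and the path is kept as it is.
        by_cases e : p = rotatePos i j p
        · convert h using 2
          exact e.symm
        · exact h.tail ⟨fun e' => e (congrArg Subtype.val e'), i, j, hij, rfl⟩)
      ⟨a.2, .refl⟩
    exact h
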